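/- Let $G$ be a discrete Abelian group, written additively, and let $\mathcal C(G)$ be the space of all functions $f:G\to\mathbb C$ with the topology of uniform convergence on compact (that is, finite) sets, i.e. of pointwise convergence. A variety on $G$ is a closed linear subspace $V$ of $\mathcal C(G)$ such that for all $f\in V$ and $y\in G$ the translate $x\mapsto f(x+y)$ belongs to $V$. An exponential monomial on $G$ is a function of the form $x\mapsto P\big(a_1(x),\dots,a_k(x)\big)\,m(x)$, where $k\geq 0$, $P$ is a complex polynomial in $k$ variables, $a_1,\dots,a_k:G\to(\mathbb C,+)$ are homomorphisms, and $m:G\to(\mathbb C\setminus\{0\},\cdot)$ is a homomorphism. We say that spectral synthesis holds on $G$ if in every variety $V$ on $G$ the exponential monomials belonging to $V$ span a dense linear subspace of $V$. Then spectral synthesis holds on $G$ if and only if the torsion-free rank of $G$, i.e. the supremum of the cardinalities of the $\mathbb Z$-linearly independent subsets of $G$, is finite. -/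

import Mathlib

namespace SpectralSynthesis

variable {G : Type*} [AddCommGroup G] [TopologicalSpace G] [IsTopologicalAddGroup G]

/-- The translate `x ↦ f (x + y)` of a continuous function `f`. -/
noncomputable def translate (y : G) (f : C(G, ℂ)) : C(G, ℂ) :=
  f.comp ⟨fun x => x + y, continuous_id.add continuous_const⟩

@[simp]
theorem translate_apply (y : G) (f : C(G, ℂ)) (x : G) : translate y f x = f (x + y) := rfl

/-- A variety on `G`: a closed translation invariant linear subspace of `C(G, ℂ)`. Here `C(G, ℂ)`
carries the compact-open topology, that is, uniform convergence on compact sets. -/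
structure IsVariety (V : Submodule ℂ C(G, ℂ)) : Prop where
  isClosed : IsClosed (V : Set C(G, ℂ))
  translate_mem : ∀ f ∈ V, ∀ y : G, translate y f ∈ V

/-- An exponential monomial: `x ↦ P (a₁ x, …, aₖ x) * m x` with a complex polynomial `P` in `k`
variables, continuous additive functions `aᵢ : G → ℂ`, and an exponential `m`, i.e. a continuous
map with `m (x + y) = m x * m y` and `m 0 = 1` (such a map has no zeros). -/
def IsExponentialMonomial (f : C(G, ℂ)) : Prop :=
  ∃ (k : ℕ) (P : MvPolynomial (Fin k) ℂ) (a : Fin k → (G →ₜ+ ℂ)) (m : AddChar G ℂ),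
    Continuous m ∧ ∀ x : G, f x = MvPolynomial.eval (fun i => a i x) P * m x

/-- A variety is synthesizable if the exponential monomials belonging to it span a dense subspace
of it. -/
def IsSynthesizable (V : Submodule ℂ C(G, ℂ)) : Prop :=
  (V : Set C(G, ℂ)) ⊆
    closure (Submodule.span ℂ {f : C(G, ℂ) | f ∈ V ∧ IsExponentialMonomial f} : Set C(G, ℂ))

/-- Spectral synthesis holds on `G` if every variety on `G` is synthesizable. -/
def HoldsOn (G : Type*) [AddCommGroup G] [TopologicalSpace G] [IsTopologicalAddGroup G] : Prop :=
  ∀ V : Submodule ℂ C(G, ℂ), IsVariety V → IsSynthesizable V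

end SpectralSynthesis

/-!
The continuous dual of `C(G, ℂ)`, for discrete `G`, is the group algebra `ℂ[G]`, so varieties
correspond to ideals of `ℂ[G]`. Fix elements `y i` of `G` that form a basis of `ℚ ⊗ G` and
homomorphisms `c i : G → ℂ` dual to them (`exists_coordinates`).

If the rank is infinite, consider the quadratic form `x ↦ ∑ (c i x) ^ 2` with polar form `β`. It
lies in the variety of all functions whose second differences are proportional to `β`. The
translates of an exponential monomial span a finite-dimensional space, whereas the functions `β · y`
do not; hence every exponential monomial of that variety has vanishing second differences, and so
has every limit of their linear combinations, unlike the quadratic form (`not_holdsOn_of_infinite`).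

If the rank is finite, a functional on `ℂ[G]` vanishing on a power of a maximal ideal `𝔪 = ker χ` is
an exponential monomial (`isExponentialMonomial_of_functional`), so by duality it is enough to show
that every ideal `I` is the intersection of the ideals `I + 𝔪 ^ n` (`exists_notMem_sup_ker_pow`).
Given `f ∉ I`, choose `𝔪` containing the ideal of all `b` with `b f ∈ I`; its residue field is `ℂ`
because `ℂ[G]` is integral over the group algebra of a finitely generated subgroup
(`exists_eq_ker_of_isMaximal`). Suppose `f ∈ I + 𝔪 ^ n` for all `n`. The ring `ℂ[G]` need not be
Noetherian, but its graded ring at `𝔪` is a quotient of a polynomial ring, so finitely many elements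
of `I` already generate `I` modulo every `𝔪 ^ n` (`exists_finset_le_span_sup_pow`). These elements
and `f` lie in `ℂ[H]` for a finitely generated subgroup `H` containing the `y i`. As the quotient
maps of `ℂ[H]` by the powers of `𝔪 ∩ ℂ[H]` extend to `ℂ[G]` (`exists_extension_quotient`), the same
relation holds in the Noetherian ring `ℂ[H]`, and the Krull intersection theorem yields `r ∈ 𝔪` with
`(1 - r) f ∈ I`, contradicting the choice of `𝔪`.

The description of functionals, the generators of `𝔪` modulo `𝔪 ^ 2` and the extension of quotients
all come from one fact, `exists_unipotent_eq_exp`: a unipotent representation of `G` has the form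
`g ↦ exp (∑ c i g • e i)` with nilpotent `e i`.
-/

namespace SpectralSynthesis

open scoped nonZeroDivisors TensorProduct

/-! ### Coordinates and duality -/

/-- Every abelian group has a family `y` whose image in `ℚ ⊗ G` is a basis, together with the
coordinate homomorphisms `c` of that basis. -/
theorem exists_coordinates (G : Type*) [AddCommGroup G] :
    ∃ (ι : Type _) (y : ι → G) (c : ι → G →+ ℂ),
      (∀ i, c i (y i) = 1) ∧ (∀ i j, j ≠ i → c i (y j) = 0) ∧
      (∀ g, {i | c i g ≠ 0}.Finite) ∧
      (∀ g, ∃ N : ℕ, N ≠ 0 ∧ N • g ∈ AddSubgroup.closure (Set.range y)) ∧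
      Cardinal.mk ι = Module.rank ℤ G := by
  classical
  let f : G →ₗ[ℤ] ℚ ⊗[ℤ] G := TensorProduct.mk ℤ ℚ G 1
  have hf : IsLocalizedModule ℤ⁰ f :=
    (isLocalizedModule_iff_isBaseChange ℤ⁰ ℚ f).2 (TensorProduct.isBaseChange ℤ G ℚ)
  let b₀ := Module.Basis.ofVectorSpace ℚ (ℚ ⊗[ℤ] G)
  -- Rescale a basis of `ℚ ⊗ G` so that it consists of images of elements of `G`.
  have hs : ∀ i, ∃ (g : G) (s : ℤ⁰), (s : ℤ) • b₀ i = f g := fun i => by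
    obtain ⟨⟨g, s⟩, h⟩ := IsLocalizedModule.surj ℤ⁰ f (b₀ i)
    exact ⟨g, s, h⟩
  choose y s hys using hs
  have hs0 : ∀ i, IsUnit ((s i : ℤ) : ℚ) := fun i =>
    (Int.cast_ne_zero.2 (nonZeroDivisors.coe_ne_zero (s i))).isUnit
  let b := b₀.isUnitSMul hs0
  have hb : ∀ i, b i = f (y i) := fun i => by
    rw [← hys, Module.Basis.isUnitSMul_apply, Int.cast_smul_eq_zsmul]
  refine ⟨_, y, fun i => (algebraMap ℚ ℂ).toAddMonoidHom.comp
    ((b.coord i).toAddMonoidHom.comp f.toAddMonoidHom), ?_, ?_, ?_, ?_, ?_⟩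
  · intro i
    simp [← hb]
  · intro i j hij
    simp [← hb, hij]
  · intro g
    refine (b.repr (f g)).support.finite_toSet.subset fun i hi => ?_
    simpa using hi
  · -- A multiple of `g` agrees with an integral combination of the `y i` up to torsion.
    have key : ∀ w : ℚ ⊗[ℤ] G, ∃ N : ℕ, N ≠ 0 ∧
        ∃ z ∈ AddSubgroup.closure (Set.range y), N • w = f z := by
      intro w
      have hw : w ∈ Submodule.span ℚ (Set.range b) := by simp
      induction hw using Submodule.span_induction with
      | mem x hx =>
        obtain ⟨i, rfl⟩ := hx
        exact ⟨1, one_ne_zero, y i, AddSubgroup.subset_closure ⟨i, rfl⟩, by rw [hb, one_smul]⟩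
      | zero => exact ⟨1, one_ne_zero, 0, zero_mem _, by simp⟩
      | add u v _ _ hu hv =>
        obtain ⟨N, hN, z, hz, h⟩ := hu
        obtain ⟨N', hN', z', hz', h'⟩ := hv
        refine ⟨N * N', mul_ne_zero hN hN', N' • z + N • z',
          add_mem (nsmul_mem hz _) (nsmul_mem hz' _), ?_⟩
        rw [map_add, map_nsmul, map_nsmul, ← h, ← h', smul_add, mul_smul, mul_smul,
          smul_comm N N' u]
      | smul q u _ hu =>
        obtain ⟨N, hN, z, hz, h⟩ := hu
        refine ⟨N * q.den, mul_ne_zero hN q.den_ne_zero, q.num • z, zsmul_mem hz _, ?_⟩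
        rw [map_zsmul, ← h, ← Nat.cast_smul_eq_nsmul ℚ, ← Nat.cast_smul_eq_nsmul ℚ,
          ← Int.cast_smul_eq_zsmul ℚ, smul_smul, smul_smul, ← Rat.mul_den_eq_num]
        congr 1
        push_cast
        ring
    intro g
    obtain ⟨N, hN, z, hz, h⟩ := key (f g)
    have h0 : f (N • g - z) = 0 := by rw [map_sub, map_nsmul, h, sub_self]
    obtain ⟨t, ht⟩ := (IsLocalizedModule.eq_zero_iff ℤ⁰ f).1 h0
    have ht' : (t : ℤ) • (N • g - z) = 0 := ht
    have ht0 : (t : ℤ) ≠ 0 := nonZeroDivisors.coe_ne_zero t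
    refine ⟨(t : ℤ).natAbs * N, mul_ne_zero (Int.natAbs_ne_zero.2 ht0) hN, ?_⟩
    have h2 : (t : ℤ) • (N • g) ∈ AddSubgroup.closure (Set.range y) := by
      rw [smul_sub, sub_eq_zero] at ht'
      rw [ht']
      exact zsmul_mem hz _
    rw [mul_smul]
    rcases Int.natAbs_eq (t : ℤ) with h3 | h3
    · rw [← natCast_zsmul, ← h3]; exact h2
    · rw [h3, neg_smul] at h2
      rw [← natCast_zsmul]; exact neg_mem_iff.1 h2
  · rw [b.mk_eq_rank'', IsLocalization.rank_eq ℚ ℤ⁰ le_rfl, IsLocalizedModule.rank_eq ℤ⁰ le_rfl f]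

section Duality

variable {G : Type*}

/-- The pairing of a function `f : G → ℂ` with the elements of the group algebra, regarded as
finitely supported measures on `G`: it sends `∑ a_g g` to `∑ a_g f(g)`. -/
noncomputable def pairing (f : G → ℂ) : AddMonoidAlgebra ℂ G →ₗ[ℂ] ℂ :=
  Finsupp.linearCombination ℂ f ∘ₗ (AddMonoidAlgebra.coeffLinearEquiv ℂ).toLinearMap

@[simp]
theorem pairing_single (f : G → ℂ) (x : G) (r : ℂ) :
    pairing f (AddMonoidAlgebra.single x r) = r * f x := by
  simp [pairing]

theorem pairing_apply_single (l : AddMonoidAlgebra ℂ G →ₗ[ℂ] ℂ) :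
    pairing (fun g => l (AddMonoidAlgebra.single g 1)) = l := by
  ext x
  simp [AddMonoidAlgebra.lsingle]

theorem pairing_single_mul [AddCommGroup G] (f : G → ℂ) (y : G) (r : ℂ) (ν : AddMonoidAlgebra ℂ G) :
    pairing f (AddMonoidAlgebra.single y r * ν) = r * pairing (fun x => f (x + y)) ν := by
  suffices h : pairing f ∘ₗ LinearMap.mulLeft ℂ (AddMonoidAlgebra.single y r) =
      r • pairing (fun x => f (x + y)) from LinearMap.congr_fun h ν
  ext x
  simp [AddMonoidAlgebra.single_mul_single, add_comm]

variable [TopologicalSpace G] [DiscreteTopology G]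

/-- Hahn–Banach for the topology of pointwise convergence: a function outside the closure of a
linear subspace is separated from it by a finitely supported measure. -/
theorem exists_pairing_ne_zero_of_notMem_closure (S : Submodule ℂ C(G, ℂ)) {f : C(G, ℂ)}
    (hf : f ∉ closure (S : Set C(G, ℂ))) :
    ∃ ν : AddMonoidAlgebra ℂ G, (∀ s ∈ S, pairing s ν = 0) ∧ pairing f ν ≠ 0 := by
  classical
  contrapose! hf
  have hind := (ContinuousMap.isHomeomorph_coe (X := G) (Y := ℂ)).isInducing
  rw [hind.closure_eq_preimage_closure_image, Set.mem_preimage, mem_closure_iff]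
  intro o ho hfo
  obtain ⟨F, u, hu, hFu⟩ := isOpen_pi_iff.1 ho f hfo
  -- A subspace of `ℂ^F` is cut out by linear functionals, so some element of `S` agrees with `f`
  -- exactly on the finite set `F`.
  let res : C(G, ℂ) →ₗ[ℂ] (F → ℂ) :=
    { toFun := fun g x => g x, map_add' := fun _ _ => rfl, map_smul' := fun _ _ => rfl }
  have hmem : res f ∈ S.map res := by
    by_contra hn
    obtain ⟨l, hl, hl'⟩ := Submodule.exists_le_ker_of_notMem hn
    let ν : AddMonoidAlgebra ℂ G := ∑ x : F, AddMonoidAlgebra.single x.1 (l (Pi.single x 1))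
    have hν : ∀ g : C(G, ℂ), pairing g ν = l (res g) := fun g => by
      rw [LinearMap.pi_apply_eq_sum_univ l (res g), map_sum]
      refine Finset.sum_congr rfl fun x _ => ?_
      rw [pairing_single, smul_eq_mul, mul_comm]
      congr 2
      ext j
      simp [Pi.single_apply, eq_comm]
    refine hl ?_
    rw [← hν]
    exact hf ν fun s hs => (hν s).trans (hl' (Submodule.mem_map_of_mem hs))
  obtain ⟨s, hs, hsf⟩ := hmem
  refine ⟨s, hFu fun x hx => ?_, s, hs, rfl⟩
  have : s x = f x := congr_fun hsf ⟨x, hx⟩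
  rw [this]
  exact (hu x hx).2

end Duality

/-! ### Failure of synthesis in infinite rank -/

section Translates

variable {G : Type*} [AddCommGroup G]

/-- The translates of `f` lie in a finite-dimensional space of functions. -/
def HasFiniteTranslates (f : G → ℂ) : Prop :=
  ∃ W : Submodule ℂ (G → ℂ), W.FG ∧ ∀ y, (fun x => f (x + y)) ∈ W

theorem hasFiniteTranslates_const (r : ℂ) : HasFiniteTranslates (fun _ : G => r) :=
  ⟨Submodule.span ℂ {fun _ => r}, Submodule.fg_span_singleton _,
    fun _ => Submodule.mem_span_singleton_self _⟩

theorem HasFiniteTranslates.add {f g : G → ℂ} (hf : HasFiniteTranslates f)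
    (hg : HasFiniteTranslates g) : HasFiniteTranslates (fun x => f x + g x) := by
  obtain ⟨W, hW, h⟩ := hf
  obtain ⟨W', hW', h'⟩ := hg
  exact ⟨W ⊔ W', hW.sup hW', fun y => Submodule.add_mem_sup (h y) (h' y)⟩

theorem HasFiniteTranslates.mul {f g : G → ℂ} (hf : HasFiniteTranslates f)
    (hg : HasFiniteTranslates g) : HasFiniteTranslates (fun x => f x * g x) := by
  obtain ⟨W, hW, h⟩ := hf
  obtain ⟨W', hW', h'⟩ := hg
  exact ⟨W * W', hW.mul hW', fun y => Submodule.mul_mem_mul (h y) (h' y)⟩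

theorem hasFiniteTranslates_addMonoidHom (a : G →+ ℂ) : HasFiniteTranslates a := by
  refine ⟨Submodule.span ℂ {⇑a, 1}, Submodule.fg_span (by simp), fun y => ?_⟩
  refine Submodule.mem_span_pair.2 ⟨1, a y, ?_⟩
  ext x
  simp

theorem hasFiniteTranslates_addChar (m : AddChar G ℂ) : HasFiniteTranslates m := by
  refine ⟨Submodule.span ℂ {⇑m}, Submodule.fg_span_singleton _, fun y => ?_⟩
  refine Submodule.mem_span_singleton.2 ⟨m y, ?_⟩
  ext x
  simp [AddChar.map_add_eq_mul, mul_comm]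

theorem IsExponentialMonomial.hasFiniteTranslates [TopologicalSpace G] [IsTopologicalAddGroup G]
    {f : C(G, ℂ)} (hf : IsExponentialMonomial f) : HasFiniteTranslates f := by
  obtain ⟨k, P, a, m, -, h⟩ := hf
  have hP : HasFiniteTranslates fun x => MvPolynomial.eval (fun i => a i x) P := by
    clear h
    induction P using MvPolynomial.induction_on with
    | C r => simpa using hasFiniteTranslates_const (G := G) r
    | add p q hp hq => simpa using hp.add hq
    | mul_X p i hp => simpa using hp.mul (hasFiniteTranslates_addMonoidHom (a i : G →+ ℂ))
  have := hP.mul (hasFiniteTranslates_addChar m)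
  rwa [show (f : G → ℂ) = _ from funext h]

end Translates

section Failure

variable {G : Type*} [AddCommGroup G] [TopologicalSpace G]

/-- The functions `φ` whose second differences `φ (x + y) - φ x - φ y + φ 0` are proportional to
`β x y`. The proportionality factor is read off at the pair `(x₀, x₀)`. -/
def quadraticVariety (β : G → G → ℂ) (x₀ : G) : Submodule ℂ C(G, ℂ) where
  carrier := {φ | ∀ x y, β x₀ x₀ * (φ (x + y) - φ x - φ y + φ 0) =
    β x y * (φ (x₀ + x₀) - φ x₀ - φ x₀ + φ 0)}
  zero_mem' := by simp
  add_mem' := by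
    intro φ ψ hφ hψ x y
    have h1 := hφ x y
    have h2 := hψ x y
    simp only [ContinuousMap.add_apply]
    linear_combination h1 + h2
  smul_mem' := by
    intro r φ hφ x y
    have h1 := hφ x y
    simp only [ContinuousMap.smul_apply, smul_eq_mul]
    linear_combination r * h1

/-- If the functions `β · y` span a space of infinite dimension, then a function of the variety with
nonzero second difference at `(x₀, x₀)` is not an exponential monomial: its translates would span
all `β · y` modulo the function itself and the constants. -/
theorem secondDifference_eq_zero_of_hasFiniteTranslates {β : G → G → ℂ} {x₀ : G}
    (hinf : ∀ W : Submodule ℂ (G → ℂ), W.FG → ∃ y, (fun x => β x y) ∉ W)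
    {φ : C(G, ℂ)} (hφ : φ ∈ quadraticVariety β x₀) (hfin : HasFiniteTranslates φ) :
    φ (x₀ + x₀) - φ x₀ - φ x₀ + φ 0 = 0 := by
  by_contra hne
  obtain ⟨W, hW, h⟩ := hfin
  obtain ⟨y, hy⟩ := hinf (W ⊔ Submodule.span ℂ {1}) (hW.sup (Submodule.fg_span_singleton _))
  have h1 : (φ : G → ℂ) ∈ W := by simpa using h 0
  have h2 : (fun x => β x y) = (β x₀ x₀ / (φ (x₀ + x₀) - φ x₀ - φ x₀ + φ 0)) •
      (((fun x => φ (x + y)) - ⇑φ) + (φ 0 - φ y) • (1 : G → ℂ)) := by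
    ext x
    have := hφ x y
    simp only [Pi.smul_apply, Pi.add_apply, Pi.sub_apply, Pi.one_apply, smul_eq_mul, mul_one]
    rw [div_mul_eq_mul_div, eq_div_iff hne, ← this]
    ring
  refine hy (h2 ▸ Submodule.smul_mem _ _ (Submodule.add_mem_sup (W.sub_mem (h y) h1)
    (Submodule.smul_mem _ _ (Submodule.mem_span_singleton_self _))))

theorem isVariety_quadraticVariety [IsTopologicalAddGroup G] {β : G → G → ℂ} {x₀ : G}
    (hβ : ∀ x y z, β x (y + z) = β x y + β x z) (h₀ : β x₀ x₀ ≠ 0) :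
    IsVariety (quadraticVariety β x₀) where
  isClosed := by
    have : (quadraticVariety β x₀ : Set C(G, ℂ)) = ⋂ (x : G) (y : G),
        {φ : C(G, ℂ) | β x₀ x₀ * (φ (x + y) - φ x - φ y + φ 0) =
          β x y * (φ (x₀ + x₀) - φ x₀ - φ x₀ + φ 0)} := by
      ext φ
      simp [quadraticVariety]
    rw [this]
    refine isClosed_iInter fun x => isClosed_iInter fun y => isClosed_eq ?_ ?_ <;> fun_prop
  translate_mem := by
    intro φ hφ z
    have key : ∀ x y, β x₀ x₀ * (φ (x + y + z) - φ (x + z) - φ (y + z) + φ (0 + z)) =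
        β x y * (φ (x₀ + x₀) - φ x₀ - φ x₀ + φ 0) := fun x y => by
      have h1 := hφ x (y + z)
      have h2 := hφ x z
      rw [hβ, ← add_assoc] at h1
      rw [zero_add]
      linear_combination h1 - h2
    intro x y
    have h1 := key x y
    have h2 := mul_left_cancel₀ h₀ (key x₀ x₀)
    simp only [translate_apply]
    rw [h1, h2]

/-- The quadratic form `∑ (c i) ^ 2` is not a limit of exponential polynomials of the variety it
lies in. -/
theorem not_holdsOn_of_infinite [DiscreteTopology G] {ι : Type*} [Infinite ι] {y : ι → G}
    {c : ι → G →+ ℂ} (hc : ∀ i, c i (y i) = 1) (hc' : ∀ i j, j ≠ i → c i (y j) = 0)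
    (hfin : ∀ g, {i | c i g ≠ 0}.Finite) : ¬ HoldsOn G := by
  let β : G → G → ℂ := fun x z => ∑ᶠ i, c i x * c i z
  have hsupp : ∀ x z, (Function.support fun i => c i x * c i z).Finite := fun x z =>
    (hfin x).subset fun i hi => left_ne_zero_of_mul hi
  have hβ : ∀ x u v, β x (u + v) = β x u + β x v := fun x u v => by
    simp only [β, map_add, mul_add]
    exact finsum_add_distrib (hsupp x u) (hsupp x v)
  have hβ' : ∀ u v x, β (u + v) x = β u x + β v x := fun u v x => by
    simp only [β, map_add, add_mul]
    exact finsum_add_distrib (hsupp u x) (hsupp v x)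
  have hβc : ∀ x j, β x (y j) = c j x := fun x j => by
    simp only [β]
    rw [finsum_eq_single _ j fun i hi => by rw [hc' i j hi.symm, mul_zero], hc, mul_one]
  obtain ⟨i₀⟩ := (inferInstance : Nonempty ι)
  have h₀ : β (y i₀) (y i₀) = 1 := by rw [hβc, hc]
  have h₀' : β (y i₀) (y i₀) ≠ 0 := by rw [h₀]; exact one_ne_zero
  have hlin : LinearIndependent ℂ fun i => (c i : G → ℂ) := by
    rw [linearIndependent_iff']
    intro s r hr j hj
    have := congr_fun hr (y j)
    simp only [Finset.sum_apply, Pi.smul_apply, smul_eq_mul, Pi.zero_apply] at this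
    rwa [Finset.sum_eq_single j (fun i _ hi => by rw [hc' i j hi.symm, mul_zero])
      (fun h => absurd hj h), hc, mul_one] at this
  have hinf : ∀ W : Submodule ℂ (G → ℂ), W.FG → ∃ z, (fun x => β x z) ∉ W := by
    intro W hW
    by_contra! hall
    have : Module.Finite ℂ W := Module.Finite.iff_fg.2 hW
    have hmem : ∀ i, (c i : G → ℂ) ∈ W := fun i => by
      have := hall (y i)
      simpa only [hβc] using this
    have hli : LinearIndependent ℂ fun i => (⟨c i, hmem i⟩ : W) :=
      LinearIndependent.of_comp W.subtype hlin
    have := hli.finite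
    exact not_finite ι
  intro hold
  let f : C(G, ℂ) := ⟨fun x => β x x, continuous_of_discreteTopology⟩
  have hfx : ∀ x, f x = β x x := fun _ => rfl
  have hβsymm : ∀ x z, β x z = β z x := fun x z => by simp only [β, mul_comm]
  have hf : ∀ x z, f (x + z) - f x - f z + f 0 = 2 * β x z := fun x z => by
    have h00 : β 0 0 = 0 := by simpa using hβ 0 0 0
    rw [hfx, hfx, hfx, hfx, hβ, hβ', hβ', h00, hβsymm z x]
    ring
  have hfV : f ∈ quadraticVariety β (y i₀) := fun x z => by
    rw [hf, hf]
    ring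
  have hcl := hold _ (isVariety_quadraticVariety hβ h₀') hfV
  -- The closed subspace `Z` contains the exponential monomials of the variety but not `f`.
  let Z : Submodule ℂ C(G, ℂ) :=
    { carrier := {φ | φ (y i₀ + y i₀) - φ (y i₀) - φ (y i₀) + φ 0 = 0}
      zero_mem' := by simp
      add_mem' := by
        intro φ ψ h1 h2
        simp only [Set.mem_ofPred_eq, ContinuousMap.add_apply] at *
        linear_combination h1 + h2
      smul_mem' := by
        intro r φ h1
        simp only [Set.mem_ofPred_eq, ContinuousMap.smul_apply, smul_eq_mul] at *
        linear_combination r * h1 }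
  have hZ : IsClosed (Z : Set C(G, ℂ)) := by
    refine isClosed_eq ?_ ?_ <;> fun_prop
  have hle : Submodule.span ℂ {φ : C(G, ℂ) | φ ∈ quadraticVariety β (y i₀) ∧
      IsExponentialMonomial φ} ≤ Z := Submodule.span_le.2 fun φ hφ =>
    secondDifference_eq_zero_of_hasFiniteTranslates hinf hφ.1 hφ.2.hasFiniteTranslates
  have hfZ : f ∈ Z := closure_minimal (SetLike.coe_subset_coe.2 hle) hZ hcl
  have : (2 : ℂ) * β (y i₀) (y i₀) = 0 := by
    rw [← hf]
    exact hfZ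
  rw [h₀] at this
  norm_num at this

end Failure

/-! ### Unipotent representations -/

section Unipotent

variable {Q : Type*} [CommRing Q] [Algebra ℚ Q]

/-- Logarithms of unipotent elements exist: the truncated exponential series is a polynomial whose
derivative at `0` is `1`, so Newton's method solves `exp e = u`. -/
theorem exists_isNilpotent_exp_eq {N : ℕ} (hN : ∀ x : Q, IsNilpotent x → x ^ N = 0) {u : Q}
    (hu : IsNilpotent (u - 1)) : ∃ e : Q, IsNilpotent e ∧ IsNilpotent.exp e = u := by
  -- The exponent is raised so that the linear term of the series is always present.
  have hN' : ∀ x : Q, IsNilpotent x → x ^ (N + 2) = 0 := fun x hx => by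
    rw [pow_add, hN x hx, zero_mul]
  let P : Polynomial Q := ∑ j ∈ Finset.range (N + 2),
    Polynomial.monomial j (algebraMap ℚ Q ((j.factorial : ℚ)⁻¹)) - Polynomial.C u
  have hP : ∀ x, Polynomial.aeval x P =
      ∑ j ∈ Finset.range (N + 2), ((j.factorial : ℚ)⁻¹) • x ^ j - u := fun x => by
    simp [P, Algebra.smul_def]
  have h0 : IsNilpotent (Polynomial.aeval (0 : Q) P) := by
    rw [hP, Finset.sum_range_succ', Finset.sum_eq_zero (fun j _ => by simp)]
    rw [← isNilpotent_neg_iff]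
    simpa using hu
  have h1 : IsUnit (Polynomial.aeval (0 : Q) (Polynomial.derivative P)) := by
    have : Polynomial.aeval (0 : Q) (Polynomial.derivative P) = 1 := by
      simp only [P, Polynomial.derivative_sub, Polynomial.derivative_C,
        Polynomial.derivative_monomial, map_sum, sub_zero]
      rw [Finset.sum_eq_single 1]
      · simp
      · intro j _ hj
        rcases j with _ | _ | j
        · simp
        · exact absurd rfl hj
        · simp [Polynomial.aeval_def, Polynomial.eval₂_monomial]
      · simp
    rw [this]
    exact isUnit_one
  obtain ⟨e, ⟨he, he'⟩, -⟩ := Polynomial.existsUnique_nilpotent_sub_and_aeval_eq_zero h0 h1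
  have hen : IsNilpotent e := by
    rw [zero_sub, isNilpotent_neg_iff] at he
    exact he
  exact ⟨e, hen, by rw [IsNilpotent.exp_eq_sum (hN' e hen), ← sub_eq_zero, ← hP, he']⟩

/-- Unipotent elements have no torsion. -/
theorem eq_one_of_pow_eq_one_of_isNilpotent_sub_one {w : Q} (hw : IsNilpotent (w - 1)) {N : ℕ}
    (hN : N ≠ 0) (h : w ^ N = 1) : w = 1 := by
  have h1 : IsNilpotent (∑ j ∈ Finset.range N, w ^ j - (N : Q)) := by
    have : ∑ j ∈ Finset.range N, w ^ j - (N : Q) = ∑ j ∈ Finset.range N, (w ^ j - 1) := by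
      simp [Finset.sum_sub_distrib]
    rw [this]
    refine isNilpotent_sum fun j _ => ?_
    obtain ⟨d, hd⟩ := sub_dvd_pow_sub_pow w 1 j
    rw [one_pow] at hd
    rw [hd]
    exact (Commute.all _ _).isNilpotent_mul_right hw
  have h2 : IsUnit (∑ j ∈ Finset.range N, w ^ j) := by
    have hNu : IsUnit (N : Q) := by
      rw [← map_natCast (algebraMap ℚ Q)]
      exact (IsUnit.mk0 _ (Nat.cast_ne_zero.2 hN)).map _
    have := h1.isUnit_add_right_of_commute hNu (Commute.all _ _)
    rwa [sub_add_cancel] at this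
  have h3 := geom_sum_mul w N
  rw [h, sub_self] at h3
  exact sub_eq_zero.1 ((h2.mul_right_eq_zero).1 h3)

/-- A unipotent representation of an abelian group of finite rank is the exponential of a linear
combination of the coordinate functions with nilpotent coefficients. Indeed both sides are
homomorphisms that agree on the basis `y`, hence on a subgroup with torsion quotient, and the group
of unipotent elements is torsion-free. -/
theorem exists_unipotent_eq_exp [Algebra ℂ Q] {K ι : Type*} [AddCommGroup K] [Fintype ι] {y : ι → K}
    {c : ι → K →+ ℂ} (hc : ∀ i, c i (y i) = 1) (hc' : ∀ i j, j ≠ i → c i (y j) = 0)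
    (hy : ∀ g, ∃ N : ℕ, N ≠ 0 ∧ N • g ∈ AddSubgroup.closure (Set.range y))
    {N : ℕ} (hN : ∀ x : Q, IsNilpotent x → x ^ N = 0)
    (u : Multiplicative K →* Q) (hu : ∀ g, IsNilpotent (u g - 1)) :
    ∃ e : ι → Q, (∀ i, IsNilpotent (e i)) ∧
      ∀ g : K, u (Multiplicative.ofAdd g) = IsNilpotent.exp (∑ i, c i g • e i) := by
  choose e he hexp using fun i =>
    exists_isNilpotent_exp_eq hN (hu (Multiplicative.ofAdd (y i)))
  refine ⟨e, he, ?_⟩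
  have hnil : ∀ g : K, IsNilpotent (∑ i, c i g • e i) := fun g =>
    isNilpotent_sum fun i _ => (he i).smul _
  have hE : ∀ g h : K, IsNilpotent.exp (∑ i, c i (g + h) • e i) =
      IsNilpotent.exp (∑ i, c i g • e i) * IsNilpotent.exp (∑ i, c i h • e i) := fun g h => by
    rw [← IsNilpotent.exp_add_of_commute (Commute.all _ _) (hnil g) (hnil h)]
    simp [add_smul, Finset.sum_add_distrib]
  -- The quotient of the two representations.
  let v : Multiplicative K →* Q :=
    { toFun := fun g => u g * IsNilpotent.exp (∑ i, c i (-g.toAdd) • e i)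
      map_one' := by simp [IsNilpotent.exp_zero]
      map_mul' := fun g h => by
        rw [map_mul, toAdd_mul, neg_add, hE]
        ring }
  have hinv : ∀ g : K, IsNilpotent.exp (∑ i, c i (-g) • e i) *
      IsNilpotent.exp (∑ i, c i g • e i) = 1 := fun g => by
    rw [← hE]
    simp [IsNilpotent.exp_zero]
  have hv : ∀ g, IsNilpotent (v g - 1) := fun g => by
    have h1 := IsNilpotent.isNilpotent_exp_sub_one (hnil (-g.toAdd))
    have h2 : v g - 1 = (u g - 1) * IsNilpotent.exp (∑ i, c i (-g.toAdd) • e i) +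
        (IsNilpotent.exp (∑ i, c i (-g.toAdd) • e i) - 1) := by
      simp only [v, MonoidHom.coe_mk, OneHom.coe_mk]
      ring
    rw [h2]
    exact (Commute.all _ _).isNilpotent_add ((Commute.all _ _).isNilpotent_mul_right (hu g)) h1
  let A : AddSubgroup K := (MonoidHom.ker v).toAddSubgroup'
  have hA : ∀ g : K, g ∈ A ↔ v (Multiplicative.ofAdd g) = 1 := fun g => Iff.rfl
  have hle : AddSubgroup.closure (Set.range y) ≤ A := by
    rw [AddSubgroup.closure_le]
    rintro _ ⟨i, rfl⟩
    have hsum : ∑ j, c j (y i) • e j = e i := by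
      rw [Finset.sum_eq_single i (fun j _ hj => by rw [hc' j i hj.symm, zero_smul]) (by simp), hc,
        one_smul]
    rw [SetLike.mem_coe, hA]
    simp only [v, MonoidHom.coe_mk, OneHom.coe_mk, toAdd_ofAdd]
    rw [← hexp, ← hinv (y i), hsum, mul_comm]
  intro g
  obtain ⟨n, hn, hng⟩ := hy g
  have h1 : v (Multiplicative.ofAdd g) ^ n = 1 := by
    rw [← map_pow, ← ofAdd_nsmul]
    exact hle hng
  have h2 := eq_one_of_pow_eq_one_of_isNilpotent_sub_one (hv _) hn h1
  calc u (Multiplicative.ofAdd g)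
      = v (Multiplicative.ofAdd g) * IsNilpotent.exp (∑ i, c i g • e i) := by
        simp only [v, MonoidHom.coe_mk, OneHom.coe_mk, toAdd_ofAdd]
        rw [mul_assoc, hinv, mul_one]
    _ = _ := by rw [h2, one_mul]

end Unipotent

/-! ### Leading forms of an ideal -/

section LeadingForms

variable {B ι : Type*} [CommRing B] [Algebra ℂ B] {M : Ideal B} {t : ι → B}

theorem aeval_mem_pow_of_isHomogeneous (ht : ∀ i, t i ∈ M) {n : ℕ} {p : MvPolynomial ι ℂ}
    (hp : p.IsHomogeneous n) : MvPolynomial.aeval t p ∈ M ^ n := by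
  rw [MvPolynomial.aeval_def, MvPolynomial.eval₂_eq]
  refine Ideal.sum_mem _ fun d hd => Ideal.mul_mem_left _ _ ?_
  have hdeg : ∑ i ∈ d.support, d i = n := by
    have := hp (MvPolynomial.mem_support_iff.1 hd)
    rwa [Finsupp.weight_apply, Finsupp.sum, Finset.sum_congr rfl fun i _ => by
      rw [Pi.one_apply, smul_eq_mul, mul_one]] at this
  rw [← hdeg, ← Finset.prod_pow_eq_pow_sum]
  exact Ideal.prod_mem_prod fun i _ => Ideal.pow_mem_pow (ht i) _

/-- A homogeneous element of an ideal generated by homogeneous elements has homogeneous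
coefficients. -/
theorem exists_homogeneous_combination {S : Finset (MvPolynomial ι ℂ)}
    {d : MvPolynomial ι ℂ → ℕ} (hd : ∀ f ∈ S, f.IsHomogeneous (d f)) {n : ℕ}
    {p : MvPolynomial ι ℂ} (hp : p.IsHomogeneous n)
    (hpS : p ∈ Ideal.span (S : Set (MvPolynomial ι ℂ))) :
    ∃ q : MvPolynomial ι ℂ → MvPolynomial ι ℂ, (∀ f ∈ S, d f ≤ n → (q f).IsHomogeneous (n - d f)) ∧
      (∀ f ∈ S, n < d f → q f = 0) ∧ p = ∑ f ∈ S, q f * f := by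
  classical
  obtain ⟨q, -, hq⟩ := Submodule.mem_span_finset.1 hpS
  let _ := MvPolynomial.gradedAlgebra (σ := ι) (R := ℂ)
  have hdec : ∀ (φ : MvPolynomial ι ℂ) (i : ℕ),
      (DirectSum.decompose (MvPolynomial.homogeneousSubmodule ι ℂ) φ i : MvPolynomial ι ℂ) =
        MvPolynomial.homogeneousComponent i φ := MvPolynomial.decomposition.decompose'_apply
  refine ⟨fun f => if d f ≤ n then MvPolynomial.homogeneousComponent (n - d f) (q f) else 0,
    fun f _ h => ?_, fun f _ h => if_neg h.not_ge, ?_⟩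
  · simp only [if_pos h]
    exact MvPolynomial.homogeneousComponent_isHomogeneous _ _
  · rw [← MvPolynomial.homogeneousComponent_eq_self hp, ← hq, map_sum]
    refine Finset.sum_congr rfl fun f hf => ?_
    have h := DirectSum.coe_decompose_mul_of_right_mem
      (MvPolynomial.homogeneousSubmodule ι ℂ) n (a := q f)
      ((MvPolynomial.mem_homogeneousSubmodule _ _).2 (hd f hf))
    rw [hdec, hdec] at h
    rw [smul_eq_mul, h, ite_mul, zero_mul]

variable [Fintype ι]

/-- If `B = ℂ + M` and `M` is spanned by the `t i` modulo `M ^ 2`, then the associated graded ring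
of `M` is generated by the classes of the `t i`. -/
theorem exists_leadingForm (ht : ∀ i, t i ∈ M) (h0 : ∀ b : B, ∃ r : ℂ, b - algebraMap ℂ B r ∈ M)
    (h1 : ∀ b ∈ M, ∃ a : ι → ℂ, b - ∑ i, a i • t i ∈ M ^ 2) (n : ℕ) {b : B} (hb : b ∈ M ^ n) :
    ∃ p : MvPolynomial ι ℂ, p.IsHomogeneous n ∧ b - MvPolynomial.aeval t p ∈ M ^ (n + 1) := by
  induction n generalizing b with
  | zero =>
    obtain ⟨r, hr⟩ := h0 b
    exact ⟨MvPolynomial.C r, MvPolynomial.isHomogeneous_C _ _, by simpa using hr⟩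
  | succ n ih =>
    rw [pow_succ] at hb
    induction hb using Submodule.mul_induction_on' with
    | mem_mul_mem a ha b hb =>
      obtain ⟨p, hp, hp'⟩ := ih ha
      obtain ⟨r, hr⟩ := h1 b hb
      refine ⟨p * ∑ i, MvPolynomial.C (r i) * MvPolynomial.X i,
        hp.mul (MvPolynomial.IsHomogeneous.sum _ _ _ fun i _ => ?_), ?_⟩
      · simpa using (MvPolynomial.isHomogeneous_C ι (r i)).mul (MvPolynomial.isHomogeneous_X ℂ i)
      · have hl : MvPolynomial.aeval t (∑ i, MvPolynomial.C (r i) * MvPolynomial.X i) =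
            ∑ i, r i • t i := by simp [Algebra.smul_def]
        rw [map_mul, hl]
        have h2 : a * b - MvPolynomial.aeval t p * ∑ i, r i • t i =
            (a - MvPolynomial.aeval t p) * b +
              MvPolynomial.aeval t p * (b - ∑ i, r i • t i) := by ring
        rw [h2]
        refine Ideal.add_mem _ ?_ ?_
        · rw [pow_succ]
          exact Ideal.mul_mem_mul hp' hb
        · rw [add_assoc, pow_add]
          exact Ideal.mul_mem_mul (aeval_mem_pow_of_isHomogeneous ht hp) hr
    | add x _ y _ hx hy =>
      obtain ⟨p, hp, hp'⟩ := hx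
      obtain ⟨q, hq, hq'⟩ := hy
      refine ⟨p + q, hp.add hq, ?_⟩
      rw [map_add, add_sub_add_comm]
      exact Ideal.add_mem _ hp' hq'

/-- Every ideal is, up to its closure in the `M`-adic topology, generated by finitely many
elements: their leading forms generate the ideal of leading forms of elements of `I`. -/
theorem exists_finset_le_span_sup_pow (ht : ∀ i, t i ∈ M)
    (h0 : ∀ b : B, ∃ r : ℂ, b - algebraMap ℂ B r ∈ M)
    (h1 : ∀ b ∈ M, ∃ a : ι → ℂ, b - ∑ i, a i • t i ∈ M ^ 2) (I : Ideal B) :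
    ∃ s : Finset B, (∀ b ∈ s, b ∈ I) ∧ ∀ n, I ≤ Ideal.span (s : Set B) ⊔ M ^ n := by
  classical
  -- The leading forms of the elements of `I`.
  let L : Set (MvPolynomial ι ℂ) :=
    {p | ∃ d, p.IsHomogeneous d ∧ ∃ x ∈ I, x - MvPolynomial.aeval t p ∈ M ^ (d + 1)}
  obtain ⟨S, hSL, hS⟩ := (Submodule.fg_span_iff_fg_span_finset_subset L).1
    (IsNoetherian.noetherian (Ideal.span L))
  have hch : ∀ f, ∃ d x, f ∈ S → f.IsHomogeneous d ∧ x ∈ I ∧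
      x - MvPolynomial.aeval t f ∈ M ^ (d + 1) := fun f => by
    by_cases hf : f ∈ S
    · obtain ⟨d, h, x, hx, h'⟩ := hSL hf
      exact ⟨d, x, fun _ => ⟨h, hx, h'⟩⟩
    · exact ⟨0, 0, fun h => absurd h hf⟩
  choose d x hdx using hch
  refine ⟨S.image x, fun b hb => ?_, fun n => ?_⟩
  · obtain ⟨f, hf, rfl⟩ := Finset.mem_image.1 hb
    exact (hdx f hf).2.1
  · have hspan : Ideal.span (S.image x : Set B) ≤ I := Ideal.span_le.2 fun b hb => by
      obtain ⟨f, hf, rfl⟩ := Finset.mem_image.1 hb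
      exact (hdx f hf).2.1
    induction n with
    | zero => simp
    | succ n ih =>
      intro y hy
      obtain ⟨j, hj, e, he, rfl⟩ := Submodule.mem_sup.1 (ih hy)
      have heI : e ∈ I := (Ideal.add_mem_iff_right _ (hspan hj)).1 hy
      obtain ⟨p, hp, hpe⟩ := exists_leadingForm ht h0 h1 n he
      have hpL : p ∈ Ideal.span (S : Set (MvPolynomial ι ℂ)) := by
        rw [← Ideal.submodule_span_eq, ← hS]
        exact Submodule.subset_span ⟨n, hp, e, heI, hpe⟩
      obtain ⟨q, hq, hq', hpq⟩ := exists_homogeneous_combination (fun f hf => (hdx f hf).1) hp hpL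
      have h2 : ∑ f ∈ S, MvPolynomial.aeval t (q f) * x f ∈ Ideal.span (S.image x : Set B) :=
        Ideal.sum_mem _ fun f hf => Ideal.mul_mem_left _ _
          (Ideal.subset_span (Finset.mem_coe.2 (Finset.mem_image_of_mem x hf)))
      -- Subtracting this combination of the generators cancels the leading form of `e`.
      have h3 : e - ∑ f ∈ S, MvPolynomial.aeval t (q f) * x f ∈ M ^ (n + 1) := by
        have h4 : e - ∑ f ∈ S, MvPolynomial.aeval t (q f) * x f = (e - MvPolynomial.aeval t p) -
            ∑ f ∈ S, MvPolynomial.aeval t (q f) * (x f - MvPolynomial.aeval t f) := by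
          simp only [mul_sub, Finset.sum_sub_distrib]
          rw [hpq, map_sum]
          simp only [map_mul]
          ring
        rw [h4]
        refine Ideal.sub_mem _ hpe (Ideal.sum_mem _ fun f hf => ?_)
        rcases le_or_gt (d f) n with hle | hlt
        · have : n + 1 = (n - d f) + (d f + 1) := by omega
          rw [this, pow_add]
          exact Ideal.mul_mem_mul (aeval_mem_pow_of_isHomogeneous ht (hq f hf hle))
            (hdx f hf).2.2
        · rw [hq' f hf hlt, map_zero, zero_mul]
          exact zero_mem _
      refine Submodule.mem_sup.2 ⟨j + ∑ f ∈ S, MvPolynomial.aeval t (q f) * x f,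
        Ideal.add_mem _ hj h2, _, h3, ?_⟩
      ring

end LeadingForms

/-! ### The group algebra of a group of finite rank -/

section GroupAlgebra

variable {G : Type*} [AddCommGroup G]

/-- A character `χ` of the group algebra turns each `g` into the element `χ(g)⁻¹ g`, which is
unipotent modulo every power of the maximal ideal `ker χ`. -/
noncomputable def unipotentPart (χ : AddMonoidAlgebra ℂ G →ₐ[ℂ] ℂ) :
    Multiplicative G →* AddMonoidAlgebra ℂ G where
  toFun g := AddMonoidAlgebra.single g.toAdd (χ (AddMonoidAlgebra.single (-g.toAdd) 1))
  map_one' := by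
    rw [toAdd_one, neg_zero, ← AddMonoidAlgebra.one_def, map_one, AddMonoidAlgebra.one_def]
  map_mul' g h := by
    rw [AddMonoidAlgebra.single_mul_single, ← map_mul, AddMonoidAlgebra.single_mul_single, one_mul,
      toAdd_mul, neg_add]

theorem map_single_neg_mul (χ : AddMonoidAlgebra ℂ G →ₐ[ℂ] ℂ) (g : G) :
    χ (AddMonoidAlgebra.single (-g) 1) * χ (AddMonoidAlgebra.single g 1) = 1 := by
  rw [← map_mul, AddMonoidAlgebra.single_mul_single, neg_add_cancel, one_mul,
    ← AddMonoidAlgebra.one_def, map_one]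

theorem single_eq_smul_unipotentPart (χ : AddMonoidAlgebra ℂ G →ₐ[ℂ] ℂ) (g : G) (r : ℂ) :
    AddMonoidAlgebra.single g r =
      (r * χ (AddMonoidAlgebra.single g 1)) • unipotentPart χ (Multiplicative.ofAdd g) := by
  simp only [unipotentPart, MonoidHom.coe_mk, OneHom.coe_mk, toAdd_ofAdd,
    AddMonoidAlgebra.smul_single, smul_eq_mul]
  rw [mul_assoc, mul_comm (χ _), map_single_neg_mul, mul_one]

theorem map_unipotentPart (χ : AddMonoidAlgebra ℂ G →ₐ[ℂ] ℂ) (g : Multiplicative G) :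
    χ (unipotentPart χ g) = 1 := by
  simp only [unipotentPart, MonoidHom.coe_mk, OneHom.coe_mk]
  rw [← mul_one (χ (AddMonoidAlgebra.single (-g.toAdd) 1)), ← smul_eq_mul,
    ← AddMonoidAlgebra.smul_single, map_smul, smul_eq_mul, map_single_neg_mul]

theorem unipotentPart_sub_one_mem (χ : AddMonoidAlgebra ℂ G →ₐ[ℂ] ℂ) (g : Multiplicative G) :
    unipotentPart χ g - 1 ∈ RingHom.ker χ := by
  rw [RingHom.mem_ker, map_sub, map_unipotentPart, map_one, sub_self]

theorem sub_algebraMap_mem_span_unipotentPart (χ : AddMonoidAlgebra ℂ G →ₐ[ℂ] ℂ)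
    (b : AddMonoidAlgebra ℂ G) :
    b - algebraMap ℂ _ (χ b) ∈ Submodule.span ℂ (Set.range fun g => unipotentPart χ g - 1) := by
  induction b using AddMonoidAlgebra.induction_linear with
  | zero => simp
  | add x y hx hy =>
    rw [map_add, map_add, add_sub_add_comm]
    exact add_mem hx hy
  | single g r =>
    rw [single_eq_smul_unipotentPart χ, map_smul, map_unipotentPart, smul_eq_mul, mul_one,
      Algebra.algebraMap_eq_smul_one, ← smul_sub]
    exact Submodule.smul_mem _ _ (Submodule.subset_span ⟨_, rfl⟩)

section Quotient

variable {B : Type*} [CommRing B] [Algebra ℂ B] (χ : B →ₐ[ℂ] ℂ)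

theorem mem_ker_of_isNilpotent_mk {n : ℕ} (hn : n ≠ 0) {b : B}
    (hb : IsNilpotent (Ideal.Quotient.mk (RingHom.ker χ ^ n) b)) : b ∈ RingHom.ker χ := by
  obtain ⟨k, hk⟩ := hb
  rw [← map_pow, Ideal.Quotient.eq_zero_iff_mem] at hk
  have h1 := Ideal.pow_le_self hn hk
  rw [RingHom.mem_ker, map_pow] at h1
  exact eq_zero_of_pow_eq_zero h1

theorem pow_eq_zero_of_isNilpotent_quotient {n : ℕ} (x : B ⧸ RingHom.ker χ ^ n)
    (hx : IsNilpotent x) : x ^ n = 0 := by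
  obtain ⟨b, rfl⟩ := Ideal.Quotient.mk_surjective x
  rw [← map_pow, Ideal.Quotient.eq_zero_iff_mem]
  rcases eq_or_ne n 0 with rfl | hn
  · simp
  · exact Ideal.pow_mem_pow (mem_ker_of_isNilpotent_mk χ hn hx) n

theorem isNilpotent_mk_of_mem_ker (n : ℕ) {b : B} (hb : b ∈ RingHom.ker χ) :
    IsNilpotent (Ideal.Quotient.mk (RingHom.ker χ ^ n) b) :=
  ⟨n, by rw [← map_pow, Ideal.Quotient.eq_zero_iff_mem]; exact Ideal.pow_mem_pow hb n⟩

end Quotient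

/-- Nullstellensatz for the group algebra of a group of finite rank: it is integral over the group
algebra of a finitely generated subgroup, so its residue fields are `ℂ`. -/
theorem exists_eq_ker_of_isMaximal {ι : Type*} [Finite ι] {y : ι → G}
    (hy : ∀ g, ∃ N : ℕ, N ≠ 0 ∧ N • g ∈ AddSubgroup.closure (Set.range y))
    (M : Ideal (AddMonoidAlgebra ℂ G)) [hM : M.IsMaximal] :
    ∃ χ : AddMonoidAlgebra ℂ G →ₐ[ℂ] ℂ, M = RingHom.ker χ := by
  classical
  let F := AddMonoidAlgebra ℂ G ⧸ M
  let _ : Field F := Ideal.Quotient.field M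
  let π : AddMonoidAlgebra ℂ G →ₐ[ℂ] F := Ideal.Quotient.mkₐ ℂ M
  have hπ : Function.Surjective π := Ideal.Quotient.mkₐ_surjective ℂ M
  -- `A` is the image of the group algebra of the subgroup generated by the `y i`.
  let S : Set F := Set.range (fun i => π (AddMonoidAlgebra.single (y i) 1)) ∪
    Set.range (fun i => π (AddMonoidAlgebra.single (-y i) 1))
  have hS : S.Finite := (Set.finite_range _).union (Set.finite_range _)
  let A := Algebra.adjoin ℂ S
  have hA : ∀ g ∈ AddSubgroup.closure (Set.range y), π (AddMonoidAlgebra.single g 1) ∈ A := by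
    intro g hg
    induction hg using AddSubgroup.closure_induction_left with
    | zero => rw [← AddMonoidAlgebra.one_def, map_one]; exact one_mem _
    | add_left x hx z _ hz =>
      obtain ⟨i, rfl⟩ := hx
      rw [← one_mul (1 : ℂ), ← AddMonoidAlgebra.single_mul_single, map_mul]
      exact mul_mem (Algebra.subset_adjoin (Or.inl ⟨i, rfl⟩)) hz
    | neg_add_cancel x hx z _ hz =>
      obtain ⟨i, rfl⟩ := hx
      rw [← one_mul (1 : ℂ), ← AddMonoidAlgebra.single_mul_single, map_mul]
      exact mul_mem (Algebra.subset_adjoin (Or.inr ⟨i, rfl⟩)) hz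
  have hint : Algebra.IsIntegral A F := ⟨fun x => by
    obtain ⟨b, rfl⟩ := hπ x
    induction b using AddMonoidAlgebra.induction_linear with
    | zero => rw [map_zero]; exact isIntegral_zero
    | add u v hu hv => rw [map_add]; exact hu.add hv
    | single g r =>
      have h1 : AddMonoidAlgebra.single g r = r • AddMonoidAlgebra.single g (1 : ℂ) := by simp
      obtain ⟨N, hN, hg⟩ := hy g
      have h2 : IsIntegral A (π (AddMonoidAlgebra.single g 1)) := by
        refine IsIntegral.of_pow (Nat.pos_of_ne_zero hN) ?_
        rw [← map_pow, AddMonoidAlgebra.single_pow, one_pow]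
        exact isIntegral_algebraMap (x := (⟨_, hA _ hg⟩ : A))
      rw [h1, map_smul]
      exact h2.smul r⟩
  have hinj : Function.Injective (algebraMap A F) := Subtype.val_injective
  have hAf : IsField A := isField_of_isIntegral_of_isField hinj (Field.toIsField F)
  let _ : Field A := hAf.toField
  -- By Zariski's lemma the field `A` is finite over `ℂ`.
  have hft : Algebra.FiniteType ℂ A := by
    rw [← Subalgebra.fg_iff_finiteType]
    exact ⟨hS.toFinset, by simp [A]⟩
  have hfin : Module.Finite ℂ A := finite_of_finite_type_of_isJacobsonRing ℂ A
  have hintC : Algebra.IsIntegral ℂ F := Algebra.IsIntegral.trans A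
  have hbij := IsAlgClosed.algebraMap_bijective_of_isIntegral (k := ℂ) (K := F)
  let E : ℂ ≃ₐ[ℂ] F := AlgEquiv.ofBijective (Algebra.ofId ℂ F) hbij
  refine ⟨(E.symm : F →ₐ[ℂ] ℂ).comp π, ?_⟩
  ext b
  have h : E.symm (π b) = 0 ↔ π b = 0 := by simp
  exact Ideal.Quotient.eq_zero_iff_mem.symm.trans h.symm

variable {ι : Type*} [Fintype ι] {y : ι → G} {c : ι → G →+ ℂ}

/-- The maximal ideal `ker χ` is generated modulo its square by as many elements as the rank
of `G`. -/
theorem exists_generators_mod_sq (hc : ∀ i, c i (y i) = 1) (hc' : ∀ i j, j ≠ i → c i (y j) = 0)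
    (hy : ∀ g, ∃ N : ℕ, N ≠ 0 ∧ N • g ∈ AddSubgroup.closure (Set.range y))
    (χ : AddMonoidAlgebra ℂ G →ₐ[ℂ] ℂ) :
    ∃ t : ι → AddMonoidAlgebra ℂ G, (∀ i, t i ∈ RingHom.ker χ) ∧
      ∀ b ∈ RingHom.ker χ, ∃ a : ι → ℂ, b - ∑ i, a i • t i ∈ RingHom.ker χ ^ 2 := by
  obtain ⟨e, he, hu⟩ := exists_unipotent_eq_exp hc hc' hy
    (pow_eq_zero_of_isNilpotent_quotient χ (n := 2))
    ((Ideal.Quotient.mk (RingHom.ker χ ^ 2) : _ →* _).comp (unipotentPart χ)) (fun g => by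
      simpa using isNilpotent_mk_of_mem_ker χ 2 (unipotentPart_sub_one_mem χ g))
  choose t ht using fun i => Ideal.Quotient.mk_surjective (e i)
  have hker : ∀ i, t i ∈ RingHom.ker χ := fun i =>
    mem_ker_of_isNilpotent_mk χ two_ne_zero (by rw [ht]; exact he i)
  refine ⟨t, hker, fun b hb => ?_⟩
  have hspan := sub_algebraMap_mem_span_unipotentPart χ b
  rw [(RingHom.mem_ker).1 hb, map_zero, sub_zero] at hspan
  clear hb
  induction hspan using Submodule.span_induction with
  | mem x hx =>
    obtain ⟨g, rfl⟩ := hx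
    refine ⟨fun i => c i g.toAdd, ?_⟩
    rw [← Ideal.Quotient.eq_zero_iff_mem]
    have h1 := hu g.toAdd
    have hnil : IsNilpotent (∑ i, c i g.toAdd • e i) :=
      isNilpotent_sum fun i _ => (he i).smul _
    rw [IsNilpotent.exp_eq_sum (pow_eq_zero_of_isNilpotent_quotient χ _ hnil)] at h1
    simp only [Finset.sum_range_succ, Finset.sum_range_zero, ofAdd_toAdd] at h1
    have h2 : Ideal.Quotient.mk (RingHom.ker χ ^ 2) (unipotentPart χ g) =
        1 + ∑ i, c i g.toAdd • e i := by simpa using h1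
    have h3 : ∀ (r : ℂ) (b : AddMonoidAlgebra ℂ G), Ideal.Quotient.mk (RingHom.ker χ ^ 2) (r • b) =
      r • Ideal.Quotient.mk (RingHom.ker χ ^ 2) b := fun _ _ => rfl
    rw [map_sub, map_sub, h2, map_one, map_sum]
    simp only [h3, ht]
    ring
  | zero => exact ⟨0, by simp⟩
  | add u v _ _ hu hv =>
    obtain ⟨a, ha⟩ := hu
    obtain ⟨a', ha'⟩ := hv
    refine ⟨a + a', ?_⟩
    simp only [Pi.add_apply, add_smul, Finset.sum_add_distrib]
    rw [add_sub_add_comm]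
    exact add_mem ha ha'
  | smul r u _ hu =>
    obtain ⟨a, ha⟩ := hu
    refine ⟨r • a, ?_⟩
    have : r • u - ∑ i, (r • a) i • t i = r • (u - ∑ i, a i • t i) := by
      simp [smul_sub, Finset.smul_sum, mul_smul]
    rw [this, Algebra.smul_def]
    exact Ideal.mul_mem_left _ _ ha

end GroupAlgebra

/-! ### Synthesis in finite rank -/

section IdealTheory

variable {G : Type*} [AddCommGroup G] {ι : Type*} [Fintype ι] {y : ι → G} {c : ι → G →+ ℂ}

/-- The inclusion of the group algebra of a subgroup. -/
noncomputable def subgroupAlgebraInclusion (H : AddSubgroup G) :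
    AddMonoidAlgebra ℂ H →ₐ[ℂ] AddMonoidAlgebra ℂ G :=
  AddMonoidAlgebra.mapDomainAlgHom ℂ ℂ H.subtype

theorem subgroupAlgebraInclusion_single (H : AddSubgroup G) (h : H) (r : ℂ) :
    subgroupAlgebraInclusion H (AddMonoidAlgebra.single h r) =
      AddMonoidAlgebra.single (h : G) r := by
  simp [subgroupAlgebraInclusion]

theorem exists_subgroupAlgebraInclusion_eq {H : AddSubgroup G} {b : AddMonoidAlgebra ℂ G}
    (hb : ∀ g ∈ b.coeff.support, g ∈ H) : ∃ b₁, subgroupAlgebraInclusion H b₁ = b := by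
  change b ∈ (subgroupAlgebraInclusion H).range
  rw [← AddMonoidAlgebra.sum_coeff_single b]
  exact sum_mem fun g hg => ⟨AddMonoidAlgebra.single ⟨g, hb g hg⟩ _,
    subgroupAlgebraInclusion_single H _ _⟩

/-- If `H` contains a basis of `G` up to torsion, then the thickened points `B₁ ⧸ (ker χ₁) ^ n` of
`H` are thickened points of `G`: the quotient map of the group algebra `B₁` of `H` extends to the
group algebra of `G`, by the exponential formula. -/
theorem exists_extension_quotient (hc : ∀ i, c i (y i) = 1)
    (hc' : ∀ i j, j ≠ i → c i (y j) = 0)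
    (hy : ∀ g, ∃ N : ℕ, N ≠ 0 ∧ N • g ∈ AddSubgroup.closure (Set.range y))
    (χ : AddMonoidAlgebra ℂ G →ₐ[ℂ] ℂ) {H : AddSubgroup G} (hH : ∀ i, y i ∈ H)
    {χ₁ : AddMonoidAlgebra ℂ H →ₐ[ℂ] ℂ} (hχ : χ₁ = χ.comp (subgroupAlgebraInclusion H)) (n : ℕ) :
    ∃ φ : AddMonoidAlgebra ℂ G →ₐ[ℂ] AddMonoidAlgebra ℂ H ⧸ RingHom.ker χ₁ ^ n,
      (∀ b, φ (subgroupAlgebraInclusion H b) = Ideal.Quotient.mk _ b) ∧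
      ∀ b ∈ RingHom.ker χ ^ n, φ b = 0 := by
  have hyH : ∀ g : H, ∃ N : ℕ, N ≠ 0 ∧
      N • g ∈ AddSubgroup.closure (Set.range fun i => (⟨y i, hH i⟩ : H)) := fun g => by
    obtain ⟨N, hN, hg⟩ := hy g
    refine ⟨N, hN, ?_⟩
    have himg : Set.range y = H.subtype '' Set.range fun i => (⟨y i, hH i⟩ : H) := by
      rw [← Set.range_comp]
      rfl
    rw [himg, ← AddMonoidHom.map_closure] at hg
    obtain ⟨z, hz, hzg⟩ := hg
    have : z = N • g := Subtype.ext hzg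
    rwa [← this]
  obtain ⟨e, he, hu⟩ := exists_unipotent_eq_exp (c := fun i => (c i).comp H.subtype) hc hc' hyH
    (pow_eq_zero_of_isNilpotent_quotient χ₁ (n := n))
    ((Ideal.Quotient.mk (RingHom.ker χ₁ ^ n) : _ →* _).comp (unipotentPart χ₁)) (fun g => by
      simpa using isNilpotent_mk_of_mem_ker χ₁ n (unipotentPart_sub_one_mem χ₁ g))
  have hnil : ∀ g : G, IsNilpotent (∑ i, c i g • e i) := fun g =>
    isNilpotent_sum fun i _ => (he i).smul _
  let F : Multiplicative G →* AddMonoidAlgebra ℂ H ⧸ RingHom.ker χ₁ ^ n :=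
    { toFun := fun g => χ (AddMonoidAlgebra.single g.toAdd 1) •
        IsNilpotent.exp (∑ i, c i g.toAdd • e i)
      map_one' := by
        simp [IsNilpotent.exp_zero, ← AddMonoidAlgebra.one_def]
      map_mul' := fun g h => by
        rw [smul_mul_smul_comm, ← map_mul, AddMonoidAlgebra.single_mul_single, one_mul,
          ← IsNilpotent.exp_add_of_commute (Commute.all _ _) (hnil _) (hnil _)]
        simp [add_smul, Finset.sum_add_distrib] }
  let φ := AddMonoidAlgebra.lift ℂ (AddMonoidAlgebra ℂ H ⧸ RingHom.ker χ₁ ^ n) G F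
  have hφ : ∀ (g : G) (r : ℂ), φ (AddMonoidAlgebra.single g r) =
      r • χ (AddMonoidAlgebra.single g 1) • IsNilpotent.exp (∑ i, c i g • e i) := fun g r =>
    AddMonoidAlgebra.lift_single _ _ _
  refine ⟨φ, fun b => ?_, fun b hb => ?_⟩
  · induction b using AddMonoidAlgebra.induction_linear with
    | zero => simp
    | add u v hu hv => rw [map_add, map_add, map_add, hu, hv]
    | single g r =>
      have hχg : χ₁ (AddMonoidAlgebra.single g 1) = χ (AddMonoidAlgebra.single (g : G) 1) := by
        rw [hχ, AlgHom.comp_apply, subgroupAlgebraInclusion_single]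
      have h1 : IsNilpotent.exp (∑ i, c i (g : G) • e i) =
          Ideal.Quotient.mk _ (unipotentPart χ₁ (Multiplicative.ofAdd g)) := (hu g).symm
      rw [subgroupAlgebraInclusion_single, hφ, single_eq_smul_unipotentPart χ₁, hχg, mul_smul, h1]
      rfl
  · -- `φ` maps `ker χ` to the nilpotent elements, which form the ideal `𝔫` with `𝔫 ^ n = 0`.
    let 𝔫 := (RingHom.ker χ₁).map (Ideal.Quotient.mk (RingHom.ker χ₁ ^ n))
    have h𝔫 : ∀ x, IsNilpotent x → x ∈ 𝔫 := fun x hx => by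
      obtain ⟨b, rfl⟩ := Ideal.Quotient.mk_surjective x
      rcases eq_or_ne n 0 with rfl | hn
      · have h0 : Ideal.Quotient.mk (RingHom.ker χ₁ ^ 0) b = 0 :=
          Ideal.Quotient.eq_zero_iff_mem.2 (by simp)
        rw [h0]
        exact zero_mem _
      · exact Ideal.mem_map_of_mem _ (mem_ker_of_isNilpotent_mk χ₁ hn hx)
    have hker : RingHom.ker χ ≤ 𝔫.comap φ := fun b hb => by
      have hspan := sub_algebraMap_mem_span_unipotentPart χ b
      rw [(RingHom.mem_ker).1 hb, map_zero, sub_zero] at hspan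
      clear hb
      induction hspan using Submodule.span_induction with
      | mem x hx =>
        obtain ⟨g, rfl⟩ := hx
        have h1 : φ (unipotentPart χ g) = IsNilpotent.exp (∑ i, c i g.toAdd • e i) := by
          simp only [unipotentPart, MonoidHom.coe_mk, OneHom.coe_mk]
          rw [hφ, smul_smul, map_single_neg_mul, one_smul]
        rw [Ideal.mem_comap, map_sub, h1, map_one]
        exact h𝔫 _ (IsNilpotent.isNilpotent_exp_sub_one (hnil _))
      | zero => exact zero_mem _
      | add u v _ _ hu hv => exact add_mem hu hv
      | smul r u _ hu =>
        rw [Algebra.smul_def]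
        exact Ideal.mul_mem_left _ _ hu
    have h1 : b ∈ (𝔫 ^ n).comap φ := Ideal.le_comap_pow φ n (Ideal.pow_right_mono hker n hb)
    rwa [Ideal.mem_comap, ← Ideal.map_pow, Ideal.map_quotient_self, Ideal.mem_bot] at h1

/-- Every ideal of the group algebra of a group of finite rank is an intersection of ideals of the
form `I + 𝔪 ^ n` with `𝔪` a maximal ideal of residue field `ℂ`. -/
theorem exists_notMem_sup_ker_pow (hc : ∀ i, c i (y i) = 1)
    (hc' : ∀ i j, j ≠ i → c i (y j) = 0)
    (hy : ∀ g, ∃ N : ℕ, N ≠ 0 ∧ N • g ∈ AddSubgroup.closure (Set.range y))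
    {I : Ideal (AddMonoidAlgebra ℂ G)} {f : AddMonoidAlgebra ℂ G} (hf : f ∉ I) :
    ∃ (χ : AddMonoidAlgebra ℂ G →ₐ[ℂ] ℂ) (n : ℕ), f ∉ I ⊔ RingHom.ker χ ^ n := by
  classical
  -- The ideal of all `b` with `b * f ∈ I`.
  let J : Ideal (AddMonoidAlgebra ℂ G) :=
    Submodule.comap (LinearMap.toSpanSingleton _ (AddMonoidAlgebra ℂ G) f) I
  have hJ : ∀ b, b ∈ J ↔ b * f ∈ I := fun b => Iff.rfl
  have hJtop : J ≠ ⊤ := fun h => hf (by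
    have : (1 : AddMonoidAlgebra ℂ G) ∈ J := by rw [h]; trivial
    simpa [hJ] using this)
  obtain ⟨M, hM, hJM⟩ := Ideal.exists_le_maximal J hJtop
  obtain ⟨χ, rfl⟩ := exists_eq_ker_of_isMaximal hy M
  refine ⟨χ, ?_⟩
  by_contra! hall
  obtain ⟨t, ht, hgen⟩ := exists_generators_mod_sq hc hc' hy χ
  obtain ⟨s, hsI, hs⟩ := exists_finset_le_span_sup_pow ht
    (fun b => ⟨χ b, by rw [RingHom.mem_ker, map_sub, AlgHom.commutes]; simp⟩) hgen I
  have hfs : ∀ n, f ∈ Ideal.span (s : Set (AddMonoidAlgebra ℂ G)) ⊔ RingHom.ker χ ^ n := fun n =>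
    sup_le (hs n) le_sup_right (hall n)
  -- Descend to the Noetherian group algebra of a finitely generated subgroup.
  let T : Finset G := Finset.univ.image y ∪ (insert f s).biUnion fun b => b.coeff.support
  let H : AddSubgroup G := AddSubgroup.closure (T : Set G)
  have hyH : ∀ i, y i ∈ H := fun i => AddSubgroup.subset_closure (by simp [T])
  have hlift : ∀ b ∈ insert f s, ∃ b₁, subgroupAlgebraInclusion H b₁ = b := fun b hb =>
    exists_subgroupAlgebraInclusion_eq fun g hg => AddSubgroup.subset_closure
      (Finset.mem_coe.2 (Finset.mem_union_right _ (Finset.mem_biUnion.2 ⟨b, hb, hg⟩)))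
  have : AddGroup.FG H := (AddGroup.fg_iff_addSubgroup_fg H).2 ⟨T, rfl⟩
  have : AddMonoid.FG H := AddGroup.fg_iff_addMonoid_fg.1 this
  have : IsNoetherianRing (AddMonoidAlgebra ℂ H) := Algebra.FiniteType.isNoetherianRing ℂ _
  obtain ⟨f₁, hf₁⟩ := hlift f (Finset.mem_insert_self _ _)
  let χ₁ : AddMonoidAlgebra ℂ H →ₐ[ℂ] ℂ := χ.comp (subgroupAlgebraInclusion H)
  let J₁ : Ideal (AddMonoidAlgebra ℂ H) := Ideal.span (subgroupAlgebraInclusion H ⁻¹' s)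
  have hJ₁ : J₁ ≤ I.comap (subgroupAlgebraInclusion H) := Ideal.span_le.2 fun b hb => hsI _ hb
  have key : ∀ n, ∃ j ∈ J₁, f₁ - j ∈ RingHom.ker χ₁ ^ n := fun n => by
    obtain ⟨φ, hφ, hφ0⟩ := exists_extension_quotient hc hc' hy χ hyH (χ₁ := χ₁) rfl n
    have hle : Ideal.span (s : Set (AddMonoidAlgebra ℂ G)) ≤
        (J₁.map (Ideal.Quotient.mk (RingHom.ker χ₁ ^ n))).comap φ := Ideal.span_le.2 fun b hb => by
      obtain ⟨b₁, rfl⟩ := hlift b (Finset.mem_insert_of_mem hb)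
      rw [SetLike.mem_coe, Ideal.mem_comap, hφ]
      exact Ideal.mem_map_of_mem _ (Ideal.subset_span hb)
    obtain ⟨j, hj, x, hx, hjx⟩ := Submodule.mem_sup.1 (hfs n)
    have h1 : Ideal.Quotient.mk (RingHom.ker χ₁ ^ n) f₁ ∈
        J₁.map (Ideal.Quotient.mk (RingHom.ker χ₁ ^ n)) := by
      rw [← hφ, hf₁, ← hjx, map_add, hφ0 x hx, add_zero]
      exact hle hj
    obtain ⟨j₁, hj₁, h2⟩ := (Ideal.mem_map_iff_of_surjective _ Ideal.Quotient.mk_surjective).1 h1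
    exact ⟨j₁, hj₁, Ideal.Quotient.eq.1 h2.symm⟩
  -- The Krull intersection theorem for the module `ℂ[H] ⧸ J₁`.
  have hkrull : (Ideal.Quotient.mk J₁ f₁) ∈
      (⨅ i : ℕ, RingHom.ker χ₁ ^ i • ⊤ : Submodule (AddMonoidAlgebra ℂ H) (_ ⧸ J₁)) := by
    rw [Submodule.mem_iInf]
    intro n
    obtain ⟨j, hj, hx⟩ := key n
    have h1 : Ideal.Quotient.mk J₁ f₁ = (f₁ - j) • (1 : _ ⧸ J₁) := by
      change _ = Ideal.Quotient.mk J₁ ((f₁ - j) * 1)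
      rw [mul_one, map_sub, Ideal.Quotient.eq_zero_iff_mem.2 hj, sub_zero]
    rw [h1]
    exact Submodule.smul_mem_smul hx trivial
  obtain ⟨⟨r, hr⟩, hr'⟩ := (Ideal.mem_iInf_smul_pow_eq_bot_iff _ _).1 hkrull
  have h2 : (1 - r) * f₁ ∈ J₁ := by
    rw [← Ideal.Quotient.eq_zero_iff_mem, sub_mul, one_mul, map_sub, sub_eq_zero, map_mul]
    exact hr'.symm
  have h3 : subgroupAlgebraInclusion H (1 - r) ∈ J := by
    rw [hJ, ← hf₁, ← map_mul]
    exact hJ₁ h2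
  have h4 : χ₁ (1 - r) = 0 := hJM h3
  rw [map_sub, map_one, (RingHom.mem_ker).1 hr, sub_zero] at h4
  exact one_ne_zero h4

end IdealTheory

section Synthesis

/-- Applying a linear functional to the coefficients of a polynomial. -/
theorem exists_eval_eq_apply_eval {Q σ : Type*} [CommRing Q] [Algebra ℂ Q] (l : Q →ₗ[ℂ] ℂ)
    (P : MvPolynomial σ Q) : ∃ P' : MvPolynomial σ ℂ, ∀ a : σ → ℂ,
      MvPolynomial.eval a P' = l (MvPolynomial.eval (fun i => algebraMap ℂ Q (a i)) P) := by
  induction P using MvPolynomial.induction_on with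
  | C q => exact ⟨MvPolynomial.C (l q), fun a => by simp⟩
  | add p q hp hq =>
    obtain ⟨p', hp⟩ := hp
    obtain ⟨q', hq⟩ := hq
    exact ⟨p' + q', fun a => by simp [hp, hq]⟩
  | mul_X p i hp =>
    obtain ⟨p', hp⟩ := hp
    refine ⟨p' * MvPolynomial.X i, fun a => ?_⟩
    rw [map_mul, map_mul, MvPolynomial.eval_X, MvPolynomial.eval_X, mul_comm _ (algebraMap ℂ Q _),
      ← Algebra.smul_def, map_smul, hp, smul_eq_mul, mul_comm]

variable {G : Type*} [AddCommGroup G] {ι : Type*} [Fintype ι] {y : ι → G} {c : ι → G →+ ℂ}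
  [TopologicalSpace G] [DiscreteTopology G]

/-- Functionals on the group algebra that vanish on a power of `ker χ` are exponential monomials
with exponential `χ`. -/
theorem isExponentialMonomial_of_functional (hc : ∀ i, c i (y i) = 1)
    (hc' : ∀ i j, j ≠ i → c i (y j) = 0)
    (hy : ∀ g, ∃ N : ℕ, N ≠ 0 ∧ N • g ∈ AddSubgroup.closure (Set.range y))
    (χ : AddMonoidAlgebra ℂ G →ₐ[ℂ] ℂ) {n : ℕ}
    (l : (AddMonoidAlgebra ℂ G ⧸ RingHom.ker χ ^ n) →ₗ[ℂ] ℂ) {φ : C(G, ℂ)}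
    (hφ : ∀ g, φ g = l (Ideal.Quotient.mk _ (AddMonoidAlgebra.single g 1))) :
    IsExponentialMonomial φ := by
  obtain ⟨e, he, hu⟩ := exists_unipotent_eq_exp hc hc' hy
    (pow_eq_zero_of_isNilpotent_quotient χ (n := n))
    ((Ideal.Quotient.mk (RingHom.ker χ ^ n) : _ →* _).comp (unipotentPart χ)) (fun g => by
      simpa using isNilpotent_mk_of_mem_ker χ n (unipotentPart_sub_one_mem χ g))
  obtain ⟨P, hP⟩ := exists_eval_eq_apply_eval l (∑ j ∈ Finset.range n,
    MvPolynomial.C (algebraMap ℚ _ ((j.factorial : ℚ)⁻¹)) *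
      (∑ i, MvPolynomial.X i * MvPolynomial.C (e i)) ^ j)
  let E := Fintype.equivFin ι
  let m : AddChar G ℂ :=
    { toFun := fun g => χ (AddMonoidAlgebra.single g 1)
      map_zero_eq_one' := by rw [← AddMonoidAlgebra.one_def, map_one]
      map_add_eq_mul' := fun g h => by
        rw [← map_mul, AddMonoidAlgebra.single_mul_single, one_mul] }
  refine ⟨Fintype.card ι, MvPolynomial.rename E P,
    fun k => ⟨c (E.symm k), continuous_of_discreteTopology⟩, m, continuous_of_discreteTopology,
    fun g => ?_⟩
  have h1 : MvPolynomial.eval (fun k => c (E.symm k) g) (MvPolynomial.rename E P) =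
      MvPolynomial.eval (fun i => c i g) P := by
    rw [MvPolynomial.eval_rename]
    congr 2
    ext i
    simp
  have h2 : Ideal.Quotient.mk (RingHom.ker χ ^ n) (unipotentPart χ (Multiplicative.ofAdd g)) =
      IsNilpotent.exp (∑ i, c i g • e i) := hu g
  have hnil : IsNilpotent (∑ i, c i g • e i) := isNilpotent_sum fun i _ => (he i).smul _
  have h3 : ∀ (r : ℂ) (b : AddMonoidAlgebra ℂ G), Ideal.Quotient.mk (RingHom.ker χ ^ n) (r • b) =
    r • Ideal.Quotient.mk (RingHom.ker χ ^ n) b := fun _ _ => rfl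
  rw [hφ, single_eq_smul_unipotentPart χ, h3, one_mul, map_smul, smul_eq_mul, mul_comm, h2,
    IsNilpotent.exp_eq_sum (pow_eq_zero_of_isNilpotent_quotient χ _ hnil)]
  change _ = MvPolynomial.eval (fun k => c (E.symm k) g) (MvPolynomial.rename E P) *
    χ (AddMonoidAlgebra.single g 1)
  rw [h1, hP]
  simp only [map_sum, map_mul, map_pow, MvPolynomial.eval_C, MvPolynomial.eval_X, Algebra.smul_def]

/-- The finitely supported measures annihilating a variety form an ideal of the group algebra. -/
noncomputable def annihilatorIdeal {V : Submodule ℂ C(G, ℂ)} (hV : IsVariety V) :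
    Ideal (AddMonoidAlgebra ℂ G) where
  carrier := {ν | ∀ f ∈ V, pairing f ν = 0}
  zero_mem' := fun f _ => map_zero _
  add_mem' := fun hμ hν f hf => by rw [map_add, hμ f hf, hν f hf, add_zero]
  smul_mem' := fun b ν hν f hf => by
    rw [smul_eq_mul]
    induction b using AddMonoidAlgebra.induction_linear with
    | zero => simp
    | add u v hu hv => rw [add_mul, map_add, hu, hv, add_zero]
    | single g r =>
      rw [pairing_single_mul]
      have h := hν _ (hV.translate_mem f hf g)
      have h' : (⇑(translate g f) : G → ℂ) = fun x => f (x + g) := rfl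
      rw [h'] at h
      rw [h, mul_zero]

/-- A measure `μ` that annihilates the exponential monomials of `V` but not `V` would lie outside
`I + (ker χ) ^ n` for the annihilator `I` of `V` and some `χ` and `n`. A functional separating `μ`
from that ideal is an exponential monomial in `V` not annihilated by `μ`. -/
theorem holdsOn_of_finite_rank (hc : ∀ i, c i (y i) = 1)
    (hc' : ∀ i j, j ≠ i → c i (y j) = 0)
    (hy : ∀ g, ∃ N : ℕ, N ≠ 0 ∧ N • g ∈ AddSubgroup.closure (Set.range y)) : HoldsOn G := by
  intro V hV f hf
  by_contra hncl
  obtain ⟨μ, hμ, hμf⟩ := exists_pairing_ne_zero_of_notMem_closure _ hncl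
  have hμI : μ ∉ annihilatorIdeal hV := fun h => hμf (h f hf)
  obtain ⟨χ, n, hn⟩ := exists_notMem_sup_ker_pow hc hc' hy hμI
  have hnmem : Ideal.Quotient.mk (RingHom.ker χ ^ n) μ ∉ Submodule.restrictScalars ℂ
      ((annihilatorIdeal hV).map (Ideal.Quotient.mk (RingHom.ker χ ^ n))) := fun h => by
    obtain ⟨j, hj, h'⟩ := (Ideal.mem_map_iff_of_surjective _ Ideal.Quotient.mk_surjective).1 h
    refine hn (Submodule.mem_sup.2 ⟨j, hj, μ - j, Ideal.Quotient.eq.1 h'.symm, ?_⟩)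
    abel
  obtain ⟨l, hl, hl'⟩ := Submodule.exists_le_ker_of_notMem hnmem
  let L : AddMonoidAlgebra ℂ G →ₗ[ℂ] ℂ :=
    l ∘ₗ (Ideal.Quotient.mkₐ ℂ (RingHom.ker χ ^ n)).toLinearMap
  let φ : C(G, ℂ) := ⟨fun g => L (AddMonoidAlgebra.single g 1), continuous_of_discreteTopology⟩
  have hφL : pairing φ = L := pairing_apply_single L
  have hφV : φ ∈ V := by
    by_contra hφ
    have hφ' : φ ∉ closure (V : Set C(G, ℂ)) := by rwa [hV.isClosed.closure_eq]
    obtain ⟨ν, hν, hνφ⟩ := exists_pairing_ne_zero_of_notMem_closure _ hφ'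
    refine hνφ ?_
    rw [hφL]
    exact hl' (Ideal.mem_map_of_mem _ hν)
  have hexp : IsExponentialMonomial φ :=
    isExponentialMonomial_of_functional hc hc' hy χ l fun _ => rfl
  refine hl ?_
  have h := hμ φ (Submodule.subset_span ⟨hφV, hexp⟩)
  rw [hφL] at h
  exact h

end Synthesis

end SpectralSynthesis

theorem mainTheorem6 (G : Type*) [AddCommGroup G] [TopologicalSpace G] [DiscreteTopology G] :
    SpectralSynthesis.HoldsOn G ↔ Module.rank ℤ G < Cardinal.aleph0 := by
  obtain ⟨ι, y, c, hc, hc', hfin, hy, hι⟩ := SpectralSynthesis.exists_coordinates G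
  rw [← hι, Cardinal.lt_aleph0_iff_finite]
  constructor
  · intro h
    by_contra hinf
    rw [not_finite_iff_infinite] at hinf
    exact SpectralSynthesis.not_holdsOn_of_infinite hc hc' hfin h
  · intro h
    have := Fintype.ofFinite ι
    exact SpectralSynthesis.holdsOn_of_finite_rank hc hc' hy
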